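/- Let $R\to S$ be a surjective homomorphism of coherent commutative rings with nilpotent kernel $I$. Consider a square of functors, commuting up to natural isomorphism, $$\begin{array}{ccc}\mathfrak u&\xrightarrow{\ u\ }&\mathcal C\\ {\scriptstyle f}\downarrow&&\downarrow{\scriptstyle S\otimes_R-}\\ \mathfrak v&\xrightarrow{\ v\ }&\mathcal D\end{array}$$ in which \begin{itemize} \item $u$ is an $R$-linear functor from a small $R$-linear category to an $R$-linear Grothendieck category; \item $v$ is an $S$-linear functor from a small $S$-linear category to an $S$-linear Grothendieck category; \item every object $u(U)$, $U\in\mathfrak u$, is flat, i.e. the functor $-\otimes_R u(U)$ from finitely presented $R$-modules to $\mathcal C$ is exact, where $M\otimes_R A$ is defined by $\mathcal C(M\otimes_R A,B)\cong\mathrm{Hom}_R(M,\mathcal C(A,B))$, naturally in $B$; \item $f$ is a (not necessarily flat) deformation of linear categories, i.e. an $R$-linear functor inducing an equivalence $S\otimes_R\mathfrak u\to\mathfrak v$, where $S\otimes_R\mathfrak u$ has the objects of $\mathfrak u$ and the Hom-modules $S\otimes_R\mathfrak u(A,B)$; \item $S\otimes_R-$ is left adjoint to an abelian deformation $\mathcal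 D\to\mathcal C$, i.e. to an $R$-linear functor inducing an equivalence of $\mathcal D$ with the full subcategory of those objects of $\mathcal C$ that are annihilated by $I$. \end{itemize} For an additive functor $w:\mathfrak w\to\mathcal E$ from a small preadditive category to a Grothendieck category, call a family $(W_i\to W)_i$ in $\mathfrak w$ a covering if the family $(w(W_i)\to w(W))_i$ is jointly epimorphic in $\mathcal E$. One says that $w$ satisfies \begin{itemize} \item (G) if every $E\in\mathcal E$ admits a jointly epimorphic family $(w(W_i)\to E)_i$ with $W_i\in\mathfrak w$; \item (F) if for all $W,W'\in\mathfrak w$ and every $y:w(W')\to w(W)$ in $\mathcal E$ there are a covering $(p_i:W_i\to W')_i$ and morphisms $x_i:W_i\to W$ with $w(x_i)=y\circ w(p_i)$ for all $i$; \item (FF) if for every $x:W'\to W$ in $\mathfrak w$ with $w(x)=0$ there is a covering $(p_i:W_i\to W')_i$ with $x\circ p_i=0$ for all $i$. \end{itemize} If $v$ satisfies (G), (F) and (FF), then so does $u$. -/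

import Mathlib

open CategoryTheory CategoryTheory.Limits

universe w r s v₁ u₁ v₂ u₂

namespace LinDef



/-! ### Covering systems and the conditions (G), (F), (FF) -/

/-- A covering system on a category: a choice of covering families `(Yᵢ ⟶ X)ᵢ` (indexed by sets,
i.e. by types in a fixed universe) containing all single identities and closed under composition
of families. -/
structure CoveringSystem (C : Type*) [Category C] where
  /-- `Covers Y f` says that the family `f i : Y i ⟶ X` is a covering of `X`. -/
  Covers : ∀ {X : C} {ι : Type w} (Y : ι → C), (∀ i, Y i ⟶ X) → Prop
  covers_id : ∀ X : C, Covers (fun _ : PUnit.{w + 1} => X) (fun _ => 𝟙 X)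
  covers_comp : ∀ {X : C} {ι : Type w} {Y : ι → C} {f : ∀ i, Y i ⟶ X} {κ : ι → Type w}
    {Z : ∀ i, κ i → C} {g : ∀ i, ∀ j : κ i, Z i j ⟶ Y i},
    Covers Y f → (∀ i, Covers (Z i) (g i)) →
    Covers (fun p : Σ i, κ i => Z p.1 p.2) (fun p => g p.1 p.2 ≫ f p.1)

/-- The covering system of all epimorphic families. -/
def epiCoveringSystem (C : Type*) [Category C] : CoveringSystem.{w} C where
  Covers {X _} _ f := ∀ ⦃T : C⦄ (a b : X ⟶ T), (∀ i, f i ≫ a = f i ≫ b) → a = b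
  covers_id X T a b h := by simpa using h PUnit.unit
  covers_comp hf hg T a b h := hf a b fun i => hg i _ _ fun j => by simpa using h ⟨i, j⟩

/-- The covering system induced along a functor `u : U ⥤ V`: a family is covering if and only if
its image under `u` is. -/
def CoveringSystem.induced {U V : Type*} [Category U] [Category V]
    (Z : CoveringSystem.{w} V) (u : U ⥤ V) : CoveringSystem.{w} U where
  Covers Y f := Z.Covers (fun i => u.obj (Y i)) (fun i => u.map (f i))
  covers_id X := by simpa using Z.covers_id (u.obj X)
  covers_comp hf hg := by simpa using Z.covers_comp hf hg

section Conditions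

variable {U V : Type*} [Category U] [Category V]

/-- (G): every object of `V` has a covering by objects in the image of `u`. -/
def SatisfiesG (Z : CoveringSystem.{w} V) (u : U ⥤ V) : Prop :=
  ∀ X : V, ∃ (ι : Type w) (A : ι → U) (p : ∀ i, u.obj (A i) ⟶ X),
    Z.Covers (fun i => u.obj (A i)) p

/-- (F): for every `B`, the morphism of presheaves `U(-, B) ⟶ V(u(-), u(B))` is locally
surjective. -/
def SatisfiesF (T : CoveringSystem.{w} U) (u : U ⥤ V) : Prop :=
  ∀ (B A : U) (y : u.obj A ⟶ u.obj B),
    ∃ (ι : Type w) (Y : ι → U) (p : ∀ i, Y i ⟶ A), T.Covers Y p ∧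
      ∀ i, ∃ x : Y i ⟶ B, u.map x = u.map (p i) ≫ y

/-- (FF): for every `B`, the morphism of presheaves `U(-, B) ⟶ V(u(-), u(B))` is locally
injective. -/
def SatisfiesFF [Preadditive U] [Preadditive V] (T : CoveringSystem.{w} U) (u : U ⥤ V) : Prop :=
  ∀ (B A : U) (x : A ⟶ B), u.map x = 0 →
    ∃ (ι : Type w) (Y : ι → U) (p : ∀ i, Y i ⟶ A), T.Covers Y p ∧ ∀ i, p i ≫ x = 0

/-- The conditions (G), (F) and (FF) for an additive functor `u` into a Grothendieck category `V`:
those of `u : (U, T_u) ⟶ (V, T)`, with `T` the covering system of epimorphic families. -/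
structure SatisfiesGFFF [Preadditive U] [Preadditive V] (u : U ⥤ V) : Prop where
  G : SatisfiesG (epiCoveringSystem.{w} V) u
  F : SatisfiesF ((epiCoveringSystem.{w} V).induced u) u
  FF : SatisfiesFF ((epiCoveringSystem.{w} V).induced u) u

end Conditions

/-! ### Coherent rings and flat objects -/

/-- A commutative ring is coherent if its finitely generated ideals are finitely presented. -/
def IsCoherentRing (R : Type*) [CommRing R] : Prop :=
  ∀ I : Ideal R, I.FG → Module.FinitePresentation R I

/-- The object `T`, with the universal map `τ : M → Hom(A, T)`, is the tensor product `M ⊗_R A`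
of a module and an object of an `R`-linear category:
`Hom(T, B) ≅ Hom_R(M, Hom(A, B))`, naturally in `B`. -/
def IsTensorObj {R : Type*} [CommRing R] {C : Type*} [Category C] [Preadditive C] [Linear R C]
    {M : Type*} [AddCommGroup M] [Module R M] {A T : C} (τ : M →ₗ[R] (A ⟶ T)) : Prop :=
  ∀ ⦃B : C⦄ (φ : M →ₗ[R] (A ⟶ B)), ∃! g : T ⟶ B, ∀ m, τ m ≫ g = φ m

/-- An object `A` of an `R`-linear abelian category (`R` coherent) is flat if the functor
`- ⊗_R A` on finitely presented `R`-modules is exact, i.e. sends short exact sequences to short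
exact sequences. -/
def IsFlatObj (R : Type w) [CommRing R] {C : Type*} [Category C] [Abelian C] [Linear R C]
    (A : C) : Prop :=
  ∀ (M₁ M₂ M₃ : Type w) [AddCommGroup M₁] [AddCommGroup M₂] [AddCommGroup M₃]
    [Module R M₁] [Module R M₂] [Module R M₃]
    [Module.FinitePresentation R M₁] [Module.FinitePresentation R M₂]
    [Module.FinitePresentation R M₃]
    (i : M₁ →ₗ[R] M₂) (p : M₂ →ₗ[R] M₃),
    Function.Injective i → Function.Exact i p → Function.Surjective p →
    ∀ (E : ShortComplex C) (τ₁ : M₁ →ₗ[R] (A ⟶ E.X₁)) (τ₂ : M₂ →ₗ[R] (A ⟶ E.X₂))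
      (τ₃ : M₃ →ₗ[R] (A ⟶ E.X₃)), IsTensorObj τ₁ → IsTensorObj τ₂ → IsTensorObj τ₃ →
      (∀ m, τ₁ m ≫ E.f = τ₂ (i m)) → (∀ m, τ₂ m ≫ E.g = τ₃ (p m)) → E.ShortExact

/-! ### Linear and abelian deformations along `R → S` -/

section Deformations

variable (R S : Type*) [CommRing R] [CommRing S] [Algebra R S]

/-- `f : U ⥤ V` exhibits the `R`-linear category `U` as a (not necessarily flat) deformation of
the `S`-linear category `V`: the induced `S`-linear functor `S ⊗_R U ⥤ V` is an equivalence.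
Here `S ⊗_R U` has the objects of `U` and the Hom-modules `S ⊗_R U(A, B)`, so the conditions below
are its being essentially surjective and fully faithful. -/
structure IsLinearDeformation {U V : Type*} [Category U] [Category V] [Preadditive U]
    [Preadditive V] [Linear R U] [Linear R V] [Linear S V]
    [∀ A B : V, IsScalarTower R S (A ⟶ B)] (f : U ⥤ V) [f.Additive] [f.Linear R] : Prop where
  essSurj : f.EssSurj
  isBaseChange : ∀ A B : U,
    IsBaseChange S (f.mapLinearMap R : (A ⟶ B) →ₗ[R] (f.obj A ⟶ f.obj B))

/-- The `S`-objects of an `R`-linear category: those annihilated by the kernel of `R → S`. -/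
def annihilatedByKer (C : Type*) [Category C] [Preadditive C] [Linear R C] : ObjectProperty C :=
  fun X => ∀ r ∈ RingHom.ker (algebraMap R S), r • 𝟙 X = 0

/-- An `R`-linear functor `j : D ⥤ C` is an abelian deformation of the `S`-linear abelian category
`D` if it induces an equivalence of `D` with the full subcategory `C_S` of `S`-objects of `C`. -/
structure IsAbelianDeformation {C D : Type*} [Category C] [Category D] [Abelian C] [Abelian D]
    [Linear R C] [Linear R D] [Linear S D] [∀ A B : D, IsScalarTower R S (A ⟶ B)]
    (j : D ⥤ C) [j.Additive] [j.Linear R] : Prop where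
  annihilated : ∀ X, annihilatedByKer R S C (j.obj X)
  isEquivalence : ((annihilatedByKer R S C).lift j annihilated).IsEquivalence

end Deformations

end LinDef

open LinDef

/-!
Write `w = u ⋙ L`, which is isomorphic to `f ⋙ v`. Since `f` is essentially surjective and full,
with kernel `I • U(A, B)` on each Hom-module, the hypotheses on `v` say that `w` satisfies (G) and
(F), and that `w x = 0` implies that `x` belongs locally to `I • U(-, B)`. The unit of `L ⊣ j` is
the quotient `X ⟶ X / I X`, and every morphism out of `X` annihilated by `I` factors through it.
By Nakayama's lemma for the nilpotent ideal `I`, a family in `U` is a covering for `u` if and only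
if it is one for `w` (`Covers.of_comp`, `Covers.comp`).

*Condition (F)* (`LocallyFull.of_comp`). A morphism `y : u A ⟶ u B` is approximated successively
modulo `I ^ n (u B)`. If the error `z` lands in `I ^ n (u B)`, then AB5 makes it locally a finite
sum of terms `r k • y k` with `r k ∈ I ^ n` (`LandsIn.eq_zero_of_sums`); modulo `I ^ (n + 1)` only
the reflections of the `y k` matter, and these come locally from `U`. Flatness is not needed.

*Condition (G)* (`Generates.of_comp`). The point is that every epimorphism `π : P ⟶ u A` has lifts
of `u p` for `p` in a covering of `A` (`covers_of_epi`). If `I` annihilates the kernel `K` of `π`,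
flatness of `u A` gives `K ∩ I P = 0`, so that `P` is the pullback of `P / I P` along
`u A ⟶ u A / I (u A)` and lifts along `π` are the same as lifts along the reflection of `π`, which
exist locally by (G) and (F) for `w`. The general case follows by filtering the kernel.

*Condition (FF)* (`LocallyFaithful.of_comp`). If `u x = 0`, then locally `x = ∑ c i • x i` with
`c i ∈ I`, and by the equational criterion for flatness the relation `∑ c i • u (x i) = 0` comes
locally from relations between the `c i` (`IsFlatObj.exists_of_sum_smul_eq_zero`). By (G) and (F)
for `u` these relations can be realized in `U`, which shows that `x` belongs locally to
`I • ker u`. By iteration it belongs locally to `I ^ n • ker u` for all `n`, hence is locally zero.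

As `I` need not be finitely generated nor `R` small, `I X` is not constructed as a subobject; it
is handled through its generalized elements (`LandsIn`). Statements which hold locally are phrased
by testing the vanishing of morphisms, so that no choice of coverings is required.
-/

namespace LinDef

/-! ### Generation and filtered colimits -/

section FilteredColimits

universe v₃ u₃

variable {C : Type u₃} [Category.{v₃} C] [Abelian C]

/-- In an abelian category with exact colimits of filtered shape `J`, a morphism `z : A ⟶ colim F`
factors through the stages `F.obj j` locally on `A`: the morphisms `t : W ⟶ A` for which `t ≫ z`
factors are jointly epimorphic. They include the projections to `A` of the pullback of `z` along
the cocone, and `colim` preserves this pullback. -/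
lemma eq_zero_of_filtered_cover {J : Type w} [SmallCategory J] [IsFiltered J]
    [HasColimitsOfShape J C] [HasExactColimitsOfShape J C] {F : J ⥤ C} {c : Cocone F}
    (hc : IsColimit c) {A T : C} (z : A ⟶ c.pt) (g : A ⟶ T)
    (H : ∀ (j : J) (W : C) (t : W ⟶ A) (y : W ⟶ F.obj j), t ≫ z = y ≫ c.ι.app j → t ≫ g = 0) :
    g = 0 := by
  let zc : (Functor.const J).obj A ⟶ (Functor.const J).obj c.pt := (Functor.const J).map z
  let gc : (Functor.const J).obj A ⟶ (Functor.const J).obj T := (Functor.const J).map g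
  let j₀ : J := IsFiltered.nonempty.some
  have hconst (X : C) (j j' : J) : colimit.ι ((Functor.const J).obj X) j =
      colimit.ι ((Functor.const J).obj X) j' := by
    rw [← colimit.w _ (IsFiltered.leftToMax j j'), ← colimit.w _ (IsFiltered.rightToMax j j')]
    rfl
  have : Epi (colim.map c.ι) := by
    refine Preadditive.epi_of_cancel_zero _ fun {Q} h hh => ?_
    refine colimit.hom_ext fun j => ?_
    rw [hconst _ j j₀, comp_zero]
    refine hc.hom_ext fun i => ?_
    have := colimit.ι F i ≫= hh
    simp only [colim_map, ι_colimMap_assoc, comp_zero] at this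
    rw [hconst _ i j₀] at this
    simpa using this
  have hP := (IsPullback.of_hasPullback zc c.ι).map (colim (J := J) (C := C))
  have : Epi (colim.map (pullback.fst zc c.ι)) :=
    Abelian.epi_fst_of_isLimit _ _ hP.isLimit
  have h0 : colim.map gc = 0 := by
    rw [← cancel_epi (colim.map (pullback.fst zc c.ι)), comp_zero, ← Functor.map_comp]
    refine colimit.hom_ext fun j => ?_
    have hj : (pullback.fst zc c.ι).app j ≫ g = 0 :=
      H j _ _ ((pullback.snd zc c.ι).app j) (congr_app (pullback.condition (f := zc) (g := c.ι)) j)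
    have : (pullback.fst zc c.ι ≫ gc).app j = 0 := hj
    simp [this]
  have h1 := colimit.ι _ j₀ ≫= h0
  simp only [colim_map, ι_colimMap, comp_zero] at h1
  have h2 := h1 =≫ colimit.desc _ (Cocone.mk T (𝟙 ((Functor.const J).obj T)))
  simpa [gc] using h2

lemma exists_eq_sum_of_finite_coproduct {κ : Type*} [Fintype κ] {B : κ → C} {X W : C}
    (b : ∀ k, B k ⟶ X) (x : W ⟶ ∐ B) :
    ∃ y : ∀ k, W ⟶ B k, x ≫ Sigma.desc b = ∑ k, y k ≫ b k := by
  have : HasFiniteBiproducts C := .of_hasFiniteProducts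
  refine ⟨fun k => x ≫ (biproduct.isoCoproduct B).inv ≫ biproduct.π B k, ?_⟩
  have h : (biproduct.isoCoproduct B).inv ≫ ∑ k, biproduct.π B k ≫ b k = Sigma.desc b := by
    classical
    ext
    simp [Preadditive.comp_sum, biproduct.ι_π_assoc, dite_comp]
  rw [← h]
  simp [Preadditive.comp_sum]

/-- If every morphism that annihilates all `b i` annihilates `z`, then `z` is, locally, a finite sum
of morphisms factoring through the `b i`: the morphisms `t` for which `t ≫ z` is such a sum are
jointly epimorphic. -/
lemma eq_zero_of_finite_sums [IsGrothendieckAbelian.{w} C] {ι : Type w} {X : C} {B : ι → C}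
    (b : ∀ i, B i ⟶ X) {A T : C} (z : A ⟶ X)
    (hz : ∀ ⦃Q : C⦄ (q : X ⟶ Q), (∀ i, b i ≫ q = 0) → z ≫ q = 0) (g : A ⟶ T)
    (H : ∀ (κ : Type w) [Fintype κ] (i : κ → ι) (W : C) (t : W ⟶ A) (y : ∀ k, W ⟶ B (i k)),
      t ≫ z = ∑ k, y k ≫ b (i k) → t ≫ g = 0) :
    g = 0 := by
  have hzq : z ≫ cokernel.π (Sigma.desc b) = 0 := by
    refine hz _ fun i => ?_
    rw [← Sigma.ι_desc b i, Category.assoc, cokernel.condition, comp_zero]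
  obtain ⟨A', e, _, y, hy⟩ := (ShortComplex.exact_cokernel (Sigma.desc b)).exact_up_to_refinements
    z hzq
  dsimp at y hy
  rw [← cancel_epi e, comp_zero]
  refine eq_zero_of_filtered_cover
    (CoproductsFromFiniteFiltered.isColimitFiniteSubproductsCocone B) y _ fun s W t x hx => ?_
  obtain ⟨y', hy'⟩ := exists_eq_sum_of_finite_coproduct (fun i : s => b i.1.as) x
  rw [← Category.assoc]
  refine H s (fun i => i.1.as) W (t ≫ e) y' (Eq.trans ?_ hy')
  have hx' : t ≫ y = x ≫ Sigma.desc fun i : s => Sigma.ι B i.1.as := hx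
  have hd : (Sigma.desc fun i : s => Sigma.ι B i.1.as) ≫ Sigma.desc b =
      Sigma.desc fun i : s => b i.1.as := by ext; simp
  rw [Category.assoc, hy, ← hd, reassoc_of% hx']
  exact Category.assoc x (Sigma.desc fun i : s => Sigma.ι B i.1.as) (Sigma.desc b)

variable {R : Type*} [CommRing R] [Linear R C]

/-- The generalized element `z` of `X` belongs to the subobject `𝔞 X`: it is annihilated by every
morphism out of `X` which is annihilated by the ideal `𝔞`. -/
def LandsIn (𝔞 : Ideal R) {A X : C} (z : A ⟶ X) : Prop :=
  ∀ ⦃Q : C⦄ (q : X ⟶ Q), (∀ r ∈ 𝔞, r • q = 0) → z ≫ q = 0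

/-- A generalized element of `𝔞 X` is, locally, a finite sum of multiples by elements of `𝔞`. -/
lemma LandsIn.eq_zero_of_sums [IsGrothendieckAbelian.{w} C] {𝔞 : Ideal R} {A X T : C} {z : A ⟶ X}
    (hz : LandsIn 𝔞 z) (g : A ⟶ T)
    (H : ∀ (n : ℕ) (r : Fin n → R) (W : C) (t : W ⟶ A) (y : Fin n → (W ⟶ X)),
      (∀ k, r k ∈ 𝔞) → t ≫ z = ∑ k, r k • y k → t ≫ g = 0) :
    g = 0 := by
  -- `R` need not be small, but the multiplications by elements of `𝔞` form a small set.
  let M : Set (X ⟶ X) := {b | ∃ r ∈ 𝔞, r • 𝟙 X = b}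
  let b : Shrink.{w} M → (X ⟶ X) := fun i => ((equivShrink M).symm i).1
  have hb (i) : ∃ r ∈ 𝔞, r • 𝟙 X = b i := ((equivShrink M).symm i).2
  choose r hr hrb using hb
  refine eq_zero_of_finite_sums (B := fun _ => X) b z (fun Q q hq => hz q fun s hs => ?_) g
    fun κ _ i W t y h => ?_
  · have := hq (equivShrink M ⟨s • 𝟙 X, s, hs, rfl⟩)
    simpa [b] using this
  · let e := Fintype.equivFin κ
    refine H _ (fun k => r (i (e.symm k))) W t (fun k => y (e.symm k)) (fun k => hr _) ?_
    rw [h, ← e.symm.sum_comp]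
    refine Finset.sum_congr rfl fun k _ => ?_
    rw [← hrb, Linear.comp_smul, Category.comp_id]

end FilteredColimits

/-! ### The reflection onto the objects annihilated by an ideal -/

section Reflection

variable {R : Type*} [CommRing R] {C D : Type*} [Category C] [Category D] [Abelian C]
  [Linear R C] {I : Ideal R} {j : D ⥤ C} {L : C ⥤ D}

/-- The functor `j : D ⥤ C` identifies `D` with the full subcategory of the objects of `C` that are
annihilated by the ideal `I`. -/
structure IsAnnihilatedSubcategory (I : Ideal R) (j : D ⥤ C) : Prop where
  full : j.Full
  faithful : j.Faithful
  smul_id_eq_zero : ∀ (X : D), ∀ r ∈ I, r • 𝟙 (j.obj X) = 0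
  mem_essImage : ∀ X : C, (∀ r ∈ I, r • 𝟙 X = 0) → j.essImage X

lemma IsAbelianDeformation.isAnnihilatedSubcategory [Abelian D] {S : Type*} [CommRing S]
    [Algebra R S] [Linear R D] [Linear S D] [∀ A B : D, IsScalarTower R S (A ⟶ B)] [j.Additive]
    [j.Linear R] (hj : IsAbelianDeformation R S j) :
    IsAnnihilatedSubcategory (RingHom.ker (algebraMap R S)) j := by
  have := hj.isEquivalence
  let e := (annihilatedByKer R S C).liftCompιIso j hj.annihilated
  refine ⟨.of_iso e, .of_iso e, hj.annihilated, fun X hX => ?_⟩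
  let X' : (annihilatedByKer R S C).FullSubcategory := ⟨X, hX⟩
  let F := (annihilatedByKer R S C).lift j hj.annihilated
  exact ⟨F.objPreimage X', ⟨(annihilatedByKer R S C).ι.mapIso (F.objObjPreimageIso X')⟩⟩

/-- The reflection `X ⟶ X / I X` of an object onto the subcategory annihilated by `I`. -/
def reflection (adj : L ⊣ j) (X : C) : X ⟶ j.obj (L.obj X) := adj.unit.app X

section

omit [Abelian C]

lemma reflection_naturality (adj : L ⊣ j) {X Y : C} (f : X ⟶ Y) :
    f ≫ reflection adj Y = reflection adj X ≫ j.map (L.map f) :=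
  adj.unit.naturality f

lemma reflection_naturality_assoc (adj : L ⊣ j) {X Y : C} (f : X ⟶ Y) {Z : C}
    (h : j.obj (L.obj Y) ⟶ Z) :
    f ≫ reflection adj Y ≫ h = reflection adj X ≫ j.map (L.map f) ≫ h := by
  rw [← Category.assoc, reflection_naturality, Category.assoc]

lemma reflection_map_injective (adj : L ⊣ j) {X : C} {Y : D} {a b : L.obj X ⟶ Y}
    (h : reflection adj X ≫ j.map a = reflection adj X ≫ j.map b) : a = b :=
  (adj.homEquiv X Y).injective (by simpa only [adj.homEquiv_unit] using! h)

lemma exists_reflection_map_eq (adj : L ⊣ j) {X : C} {Y : D} (e : X ⟶ j.obj Y) :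
    ∃ a : L.obj X ⟶ Y, reflection adj X ≫ j.map a = e :=
  ⟨(adj.homEquiv X Y).symm e, (adj.homEquiv_unit X Y _).symm.trans (Equiv.apply_symm_apply _ _)⟩

end

namespace IsAnnihilatedSubcategory

variable (hj : IsAnnihilatedSubcategory I j) (adj : L ⊣ j)
include hj

lemma smul_eq_zero_left {X : D} {T : C} (g : j.obj X ⟶ T) {r : R} (hr : r ∈ I) : r • g = 0 := by
  rw [← Category.id_comp g, ← Linear.smul_comp, hj.smul_id_eq_zero X r hr, zero_comp]

lemma smul_eq_zero_right {X : D} {T : C} (g : T ⟶ j.obj X) {r : R} (hr : r ∈ I) : r • g = 0 := by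
  rw [← Category.comp_id g, ← Linear.comp_smul, hj.smul_id_eq_zero X r hr, comp_zero]

lemma exists_factorization_through_essImage {X T : C} (g : X ⟶ T) (hg : ∀ r ∈ I, r • g = 0) :
    ∃ (Y : D) (e : X ⟶ j.obj Y) (m : j.obj Y ⟶ T), g = e ≫ m ∧ Mono m := by
  have h : ∀ r ∈ I, r • 𝟙 (image g) = 0 := fun r hr => by
    rw [← cancel_mono (image.ι g), ← cancel_epi (factorThruImage g)]
    simpa using hg r hr
  obtain ⟨Y, ⟨e⟩⟩ := hj.mem_essImage _ h
  exact ⟨Y, factorThruImage g ≫ e.inv, e.hom ≫ image.ι g, by simp, inferInstance⟩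

lemma exists_reflection_comp_eq {X T : C} (g : X ⟶ T) (hg : ∀ r ∈ I, r • g = 0) :
    ∃ h : j.obj (L.obj X) ⟶ T, reflection adj X ≫ h = g := by
  obtain ⟨Y, e, m, rfl, _⟩ := hj.exists_factorization_through_essImage g hg
  obtain ⟨a, rfl⟩ := exists_reflection_map_eq adj e
  exact ⟨j.map a ≫ m, by simp⟩

lemma epi_reflection [Preadditive D] [j.Additive] (X : C) : Epi (reflection adj X) := by
  refine Preadditive.epi_of_cancel_zero _ fun {T} g hg => ?_
  obtain ⟨Y, e, m, rfl, _⟩ := hj.exists_factorization_through_essImage g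
    fun r hr => hj.smul_eq_zero_left g hr
  have := hj.full
  obtain ⟨e, rfl⟩ := j.map_surjective e
  rw [← Category.assoc, ← zero_comp (f := m), cancel_mono] at hg
  have : e = 0 := reflection_map_injective adj (hg.trans (by simp))
  simp [this]

/-- Nakayama's lemma for a nilpotent ideal. -/
lemma eq_zero_of_map_eq_zero [Preadditive D] [j.Additive] (adj : L ⊣ j) (hI : IsNilpotent I)
    {X T : C} (g : X ⟶ T) [Epi g] (hg : L.map g = 0) : g = 0 := by
  have h0 : reflection adj T = 0 := by
    rw [← cancel_epi g, reflection_naturality, hg]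
    simp
  have key (n : ℕ) : (∀ r ∈ I ^ n, r • 𝟙 T = 0) → 𝟙 T = 0 := by
    induction n with
    | zero => exact fun h => by simpa using h 1 (by simp)
    | succ n ih =>
      refine fun h => ih fun r hr => ?_
      obtain ⟨k, hk⟩ := hj.exists_reflection_comp_eq adj (r • 𝟙 T) fun s hs => by
        rw [smul_smul]
        exact h _ (by rw [pow_succ']; exact Ideal.mul_mem_mul hs hr)
      rw [← hk, h0, zero_comp]
  obtain ⟨n, hn⟩ := hI
  have : 𝟙 T = 0 := key n fun r hr => by
    rw [hn] at hr
    rw [(Submodule.mem_bot R).1 hr, zero_smul]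
  rw [← Category.comp_id g, this, comp_zero]

end IsAnnihilatedSubcategory

end Reflection

/-! ### Coverings induced by a functor -/

section Covers

variable {U C D : Type*} [Category U] [Category C] [Category D]

/-- The morphisms `p` into `A` satisfying `P` form a covering of `A`, for the coverings that `u`
induces from the epimorphic families: their images under `u` are jointly epimorphic. In a
preadditive category, this may be tested on the vanishing of one morphism `g`. -/
def Covers [Preadditive C] (u : U ⥤ C) {A : U} (P : ∀ ⦃Y : U⦄, (Y ⟶ A) → Prop) : Prop :=
  ∀ ⦃T : C⦄ (g : u.obj A ⟶ T), (∀ ⦃Y : U⦄ (p : Y ⟶ A), P p → u.map p ≫ g = 0) → g = 0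

/-- Condition (G): the images of the objects under `u` generate. -/
def Generates [Preadditive C] (u : U ⥤ C) : Prop :=
  ∀ ⦃X T : C⦄ (g : X ⟶ T), (∀ (A : U) (a : u.obj A ⟶ X), a ≫ g = 0) → g = 0

/-- Condition (F): every morphism between images under `u` comes, locally, from a morphism of
`U`. -/
def LocallyFull [Preadditive C] (u : U ⥤ C) : Prop :=
  ∀ ⦃A B : U⦄ (y : u.obj A ⟶ u.obj B),
    Covers u fun Y (p : Y ⟶ A) => ∃ x : Y ⟶ B, u.map x = u.map p ≫ y

/-- Condition (FF): every morphism that `u` annihilates is locally zero. -/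
def LocallyFaithful [Preadditive U] [Preadditive C] (u : U ⥤ C) : Prop :=
  ∀ ⦃A B : U⦄ (x : A ⟶ B), u.map x = 0 → Covers u fun Y (p : Y ⟶ A) => p ≫ x = 0

section

variable [Preadditive C] {u : U ⥤ C} {A : U} {P Q : ∀ ⦃Y : U⦄, (Y ⟶ A) → Prop}

lemma Covers.of_id (h : P (𝟙 A)) : Covers u P := fun T g hg => by
  simpa using hg _ h

lemma Covers.mono (hP : Covers u P) (h : ∀ ⦃Y : U⦄ (p : Y ⟶ A), P p → Q p) : Covers u Q :=
  fun _ g hg => hP g fun _ p hp => hg p (h p hp)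

lemma Covers.trans (hP : Covers u P)
    (h : ∀ ⦃Y : U⦄ (p : Y ⟶ A), P p → Covers u fun Z (q : Z ⟶ Y) => Q (q ≫ p)) :
    Covers u Q :=
  fun _ g hg => hP g fun _ p hp => h p hp _ fun _ q hq => by
    simpa using hg _ hq

/-- Finitely many morphisms lift simultaneously on a common covering. -/
lemma LocallyFull.covers_finset (hu : LocallyFull u) {κ : Type*} (s : Finset κ) (B : κ → U)
    (y : ∀ k, u.obj A ⟶ u.obj (B k)) :
    Covers u fun Y (p : Y ⟶ A) => ∀ k ∈ s, ∃ x : Y ⟶ B k, u.map x = u.map p ≫ y k := by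
  classical
  induction s using Finset.induction_on with
  | empty => exact .of_id (by simp)
  | insert a s _ ih =>
    refine ih.trans fun Y p hp => (hu (u.map p ≫ y a)).mono fun Z q ⟨x, hx⟩ k hk => ?_
    obtain rfl | hk := Finset.mem_insert.1 hk
    · exact ⟨x, by simpa using hx⟩
    · obtain ⟨x', hx'⟩ := hp k hk
      exact ⟨q ≫ x', by simp [hx']⟩

/-- If `u` satisfies the conditions (G) and (F), every generalized element `c : W ⟶ u.obj A`
together with finitely many `y k : W ⟶ u.obj (B k)` is, locally on `W`, the image of morphisms
of `U`. -/
lemma LocallyFull.eq_zero_of_lifts (hu : LocallyFull u) (hG : Generates u) {κ : Type*} [Fintype κ]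
    {B : κ → U} {W T : C} (t : W ⟶ u.obj A) (y : ∀ k, W ⟶ u.obj (B k)) (g : W ⟶ T)
    (H : ∀ (Y : U) (c : u.obj Y ⟶ W) (p : Y ⟶ A) (x : ∀ k, Y ⟶ B k), u.map p = c ≫ t →
      (∀ k, u.map (x k) = c ≫ y k) → c ≫ g = 0) : g = 0 := by
  refine hG g fun Y c => hu (c ≫ t) _ fun Z q hq => ?_
  obtain ⟨p, hp⟩ := hq
  refine hu.covers_finset Finset.univ B (fun k => u.map q ≫ c ≫ y k) _ fun Z' q' hq' => ?_
  choose x hx using fun k => hq' k (Finset.mem_univ k)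
  have := H Z' (u.map q' ≫ u.map q ≫ c) (q' ≫ p) x (by simp [hp]) (by simp [hx])
  simpa using this

end

/-- A family is covering for `u` if its reflection is covering, by Nakayama's lemma. -/
lemma Covers.of_comp [Abelian C] [Preadditive D] {R : Type*} [CommRing R] [Linear R C]
    {I : Ideal R} {j : D ⥤ C} {L : C ⥤ D} [j.Additive] [L.Additive]
    (hj : IsAnnihilatedSubcategory I j) (adj : L ⊣ j) (hI : IsNilpotent I) {u : U ⥤ C} {A : U}
    {P : ∀ ⦃Y : U⦄, (Y ⟶ A) → Prop} (hP : Covers (u ⋙ L) P) : Covers u P := by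
  intro T g hg
  rw [← image.fac g, hj.eq_zero_of_map_eq_zero adj hI (factorThruImage g), zero_comp]
  refine hP _ fun Y p hp => ?_
  rw [Functor.comp_map, ← L.map_comp, ← L.map_zero]
  congr 1
  rw [← cancel_mono (image.ι g)]
  simpa using hg p hp

lemma Covers.comp [Preadditive C] [Preadditive D] {j : D ⥤ C} {L : C ⥤ D} [j.Additive]
    (adj : L ⊣ j) {u : U ⥤ C} {A : U} {P : ∀ ⦃Y : U⦄, (Y ⟶ A) → Prop} (hP : Covers u P) :
    Covers (u ⋙ L) P := by
  refine fun T g hg => reflection_map_injective adj ?_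
  rw [j.map_zero, comp_zero]
  refine hP _ fun Y p hp => ?_
  rw [reflection_naturality_assoc, ← j.map_comp]
  have : L.map (u.map p) ≫ g = 0 := hg p hp
  simp [this]

end Covers

/-! ### Lifting condition (F) -/

section LocallyFull

variable {R : Type*} [CommRing R] {U C D : Type*} [Category U] [Preadditive U] [Linear R U]
  [Category C] [Abelian C] [Linear R C] [Category D] [Preadditive D]
  {I : Ideal R} {j : D ⥤ C} {L : C ⥤ D} [j.Additive] [L.Additive]

/-- If `z` lands in `I ^ n (u B)`, then, locally, it agrees modulo `I ^ (n + 1) (u B)` with the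
image of a morphism of `U`: locally, `z` is a sum of multiples `r k • y k` with `r k ∈ I ^ n`, and
modulo `I ^ (n + 1)` only the reflection of `y k` matters, which lifts to `U`. -/
lemma LandsIn.covers_approximation [IsGrothendieckAbelian.{w} C]
    (hj : IsAnnihilatedSubcategory I j) (adj : L ⊣ j) (hI : IsNilpotent I) {u : U ⥤ C} [u.Additive]
    [u.Linear R] (hG : Generates (u ⋙ L)) (hF : LocallyFull (u ⋙ L)) {n : ℕ} {A B : U}
    {z : u.obj A ⟶ u.obj B} (hz : LandsIn (I ^ n) z) :
    Covers u fun Y (p : Y ⟶ A) => ∃ x : Y ⟶ B, LandsIn (I ^ (n + 1)) (u.map p ≫ z - u.map x) := by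
  refine Covers.of_comp hj adj hI fun T g hg => reflection_map_injective adj ?_
  rw [j.map_zero, comp_zero]
  refine hz.eq_zero_of_sums _ fun m r W t y hr ht => ?_
  have := hj.epi_reflection adj
  suffices L.map t ≫ g = 0 by
    rw [reflection_naturality_assoc, ← j.map_comp, this, j.map_zero, comp_zero]
  refine hF.eq_zero_of_lifts hG (B := fun _ => B) (L.map t) (fun k => L.map (y k)) _
    fun Y c p x hp hx => ?_
  rw [← Category.assoc, ← hp]
  refine hg p ⟨∑ k, r k • x k, fun Q q hq => ?_⟩
  obtain ⟨ζ, hζ⟩ := hj.exists_reflection_comp_eq adj (z ≫ q) fun s hs => by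
    rw [← Linear.comp_smul]
    refine hz _ fun a ha => ?_
    rw [smul_smul]
    exact hq _ (by rw [pow_succ]; exact Ideal.mul_mem_mul ha hs)
  have hρ (k : Fin m) := hj.exists_reflection_comp_eq adj (r k • q) fun s hs => by
    rw [smul_smul]
    exact hq _ (by rw [pow_succ']; exact Ideal.mul_mem_mul hs (hr k))
  choose ρ hρ using hρ
  have key : j.map (L.map t) ≫ ζ = ∑ k, j.map (L.map (y k)) ≫ ρ k := by
    rw [← cancel_epi (reflection adj W), ← reflection_naturality_assoc, hζ, reassoc_of% ht,
      Preadditive.sum_comp, Preadditive.comp_sum]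
    refine Finset.sum_congr rfl fun k _ => ?_
    rw [← reflection_naturality_assoc, hρ, Linear.smul_comp, Linear.comp_smul]
  dsimp at hp hx
  rw [Preadditive.sub_comp, sub_eq_zero, Category.assoc, ← hζ, reflection_naturality_assoc, hp,
    j.map_comp, Category.assoc, key, Functor.map_sum, Preadditive.sum_comp, Preadditive.comp_sum,
    Preadditive.comp_sum]
  refine Finset.sum_congr rfl fun k _ => ?_
  rw [Functor.map_smul, Linear.smul_comp, ← Linear.comp_smul, ← hρ, reflection_naturality_assoc, hx,
    j.map_comp, Category.assoc]

/-- Condition (F) lifts along a reflection modulo a nilpotent ideal. -/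
lemma LocallyFull.of_comp [IsGrothendieckAbelian.{w} C]
    (hj : IsAnnihilatedSubcategory I j) (adj : L ⊣ j) (hI : IsNilpotent I) {u : U ⥤ C} [u.Additive]
    [u.Linear R] (hG : Generates (u ⋙ L)) (hF : LocallyFull (u ⋙ L)) : LocallyFull u := by
  intro A B y
  have key (n : ℕ) : Covers u fun Y (p : Y ⟶ A) =>
      ∃ x : Y ⟶ B, LandsIn (I ^ n) (u.map p ≫ y - u.map x) := by
    induction n with
    | zero =>
      refine .of_id ⟨0, fun Q q hq => ?_⟩
      rw [← one_smul R q, hq 1 (by simp), comp_zero]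
    | succ n ih =>
      refine ih.trans fun Y p ⟨x, hx⟩ =>
        (hx.covers_approximation hj adj hI hG hF).mono fun Z q ⟨x', hx'⟩ => ⟨q ≫ x + x', ?_⟩
      convert! hx' using 1
      simp only [Functor.map_comp, Functor.map_add, Preadditive.comp_sub, Category.assoc]
      abel
  obtain ⟨n, hn⟩ := hI
  refine (key n).mono fun Y p ⟨x, hx⟩ => ⟨x, ?_⟩
  have h := hx (𝟙 _) fun r hr => by
    rw [hn] at hr
    rw [(Submodule.mem_bot R).1 hr, zero_smul]
  rw [Category.comp_id, sub_eq_zero] at h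
  exact h.symm

end LocallyFull

/-! ### The equational criterion for flatness -/

section Flat

variable {R : Type r} [CommRing R] {C : Type*} [Category C] [Abelian C] [Linear R C]

omit [Abelian C] [Linear R C] in
lemma exists_exact_of_finitePresentation {M : Type*} [AddCommGroup M] [Module R M]
    [Module.FinitePresentation R M] {n : ℕ} (p : (Fin n → R) →ₗ[R] M)
    (hp : Function.Surjective p) :
    ∃ (m : ℕ) (q : (Fin m → R) →ₗ[R] (Fin n → R)), Function.Exact q p := by
  have : Module.Finite R (LinearMap.ker p) := .of_fg (Module.FinitePresentation.fg_ker p hp)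
  obtain ⟨m, q, hq⟩ := Module.Finite.exists_fin' R (LinearMap.ker p)
  refine ⟨m, (LinearMap.ker p).subtype ∘ₗ q, ?_⟩
  rw [LinearMap.exact_iff, LinearMap.range_comp, LinearMap.range_eq_top.2 hq]
  simp

/-- The tensor product `M ⊗ A` of a finitely presented module `M`, as the cokernel of a morphism
`A ^ m ⟶ A ^ n` given by the matrix of relations. The last clause describes the kernel of
`A ^ n ⟶ M ⊗ A`. -/
lemma exists_isTensorObj_of_presentation {M : Type*} [AddCommGroup M] [Module R M] {m n : ℕ}
    (q : (Fin m → R) →ₗ[R] (Fin n → R)) (p : (Fin n → R) →ₗ[R] M) (hqp : Function.Exact q p)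
    (hp : Function.Surjective p) (A : C) :
    ∃ (T : C) (τ : M →ₗ[R] (A ⟶ T)), IsTensorObj τ ∧
      ∀ (W : C) (a : Fin n → (W ⟶ A)), ∑ i, a i ≫ τ (p (Pi.single i 1)) = 0 →
        ∃ (W' : C) (e : W' ⟶ W) (_ : Epi e) (b : Fin m → (W' ⟶ A)),
          ∀ i, e ≫ a i = ∑ k, q (Pi.single k 1) i • b k := by
  have : HasFiniteBiproducts C := .of_hasFiniteProducts
  let f : (⨁ fun _ : Fin m => A) ⟶ ⨁ fun _ : Fin n => A :=
    biproduct.matrix fun k i => q (Pi.single k 1) i • 𝟙 A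
  have hf (B : C) (v : Fin n → (A ⟶ B)) (k : Fin m) :
      biproduct.ι _ k ≫ f ≫ biproduct.desc v =
        Fintype.linearCombination R v (q (Pi.single k 1)) := by
    simp [f, biproduct.ι_matrix_assoc, biproduct.lift_desc, Fintype.linearCombination_apply]
  let v : Fin n → (A ⟶ cokernel f) := fun i => biproduct.ι (fun _ => A) i ≫ cokernel.π f
  have hv : biproduct.desc v = cokernel.π f := by ext; simp [v]
  have hker : LinearMap.ker p ≤ LinearMap.ker (Fintype.linearCombination R v) := by
    rw [hqp.linearMap_ker_eq, LinearMap.range_le_ker_iff]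
    ext k
    simp only [LinearMap.coe_comp, LinearMap.coe_single, Function.comp_apply,
      LinearMap.zero_apply, LinearMap.zero_comp]
    rw [← hf, hv]
    simp
  let τ : M →ₗ[R] (A ⟶ cokernel f) :=
    (LinearMap.ker p).liftQ _ hker ∘ₗ (p.quotKerEquivOfSurjective hp).symm
  have hτ (a : Fin n → R) : τ (p a) = Fintype.linearCombination R v a := by
    have : (p.quotKerEquivOfSurjective hp).symm (p a) = Submodule.Quotient.mk a := by
      rw [LinearEquiv.symm_apply_eq]; rfl
    simp [τ, this]
  refine ⟨_, τ, fun B φ => ?_, fun W a ha => ?_⟩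
  · have hφ (a : Fin n → R) : φ (p a) =
        Fintype.linearCombination R (fun i => φ (p (Pi.single i 1))) a := by
      refine LinearMap.congr_fun (f := φ ∘ₗ p) ?_ a
      ext i
      simp
    refine ⟨cokernel.desc f (biproduct.desc fun i => φ (p (Pi.single i 1))) ?_, fun x => ?_,
      fun g hg => ?_⟩
    · ext k
      rw [hf, ← hφ, hqp.apply_apply_eq_zero]
      simp
    · obtain ⟨a, rfl⟩ := hp x
      rw [hτ, hφ]
      simp [Fintype.linearCombination_apply, Preadditive.sum_comp, v]
    · ext i
      have := hg (p (Pi.single i 1))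
      rw [hτ] at this
      simpa [v] using this
  · have h0 : biproduct.lift a ≫ cokernel.π f = 0 := by
      rw [← hv, biproduct.lift_desc, ← ha]
      simp [hτ]
    obtain ⟨W', e, he, y, hy⟩ := (ShortComplex.exact_cokernel f).exact_up_to_refinements _ h0
    dsimp at y hy
    refine ⟨W', e, he, fun k => y ≫ biproduct.π _ k, fun i => ?_⟩
    have := hy =≫ biproduct.π _ i
    simp only [Category.assoc, biproduct.lift_π] at this
    rw [this, biproduct.matrix_π, biproduct.desc_eq]
    simp [Preadditive.comp_sum]

/-- The equational criterion for flatness: over a coherent ring, a linear relation `∑ c i • a i = 0`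
between generalized elements of a flat object follows, locally, from linear relations between the
coefficients. With `J` the ideal of the `c i`, flatness says that `J ⊗ A ⟶ A` is a monomorphism, and
`J ⊗ A` is the quotient of `A ^ n` by these relations. -/
lemma IsFlatObj.exists_of_sum_smul_eq_zero (hR : IsCoherentRing R) {A : C} (hA : IsFlatObj R A)
    {n : ℕ} (c : Fin n → R) {W : C} (a : Fin n → (W ⟶ A)) (h : ∑ i, c i • a i = 0) :
    ∃ (W' : C) (e : W' ⟶ W) (_ : Epi e) (m : ℕ) (s : Fin m → Fin n → R) (b : Fin m → (W' ⟶ A)),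
      (∀ i, e ≫ a i = ∑ k, s k i • b k) ∧ ∀ k, ∑ i, c i * s k i = 0 := by
  let J : Ideal R := Ideal.span (Set.range c)
  have hJ : J.FG := Submodule.fg_span (Set.finite_range c)
  have := hR J hJ
  have : Module.FinitePresentation R (R ⧸ J) :=
    Module.finitePresentation_of_surjective J.mkQ J.mkQ_surjective (by rwa [Submodule.ker_mkQ])
  have hrange : LinearMap.range (Fintype.linearCombination R c) = J :=
    Fintype.range_linearCombination R c
  let p : (Fin n → R) →ₗ[R] J := (Fintype.linearCombination R c).codRestrict J fun x =>
    hrange ▸ LinearMap.mem_range_self _ x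
  have hp : Function.Surjective p := by
    rintro ⟨x, hx⟩
    obtain ⟨y, rfl⟩ := hrange.symm ▸ hx
    exact ⟨y, rfl⟩
  obtain ⟨m, q, hq⟩ := exists_exact_of_finitePresentation p hp
  obtain ⟨T₁, τ₁, h₁, hex⟩ := exists_isTensorObj_of_presentation q p hq hp A
  obtain ⟨T₃, τ₃, h₃⟩ : ∃ (T : C) (τ : (R ⧸ J) →ₗ[R] (A ⟶ T)), IsTensorObj τ := by
    obtain ⟨n', p', hp'⟩ := Module.Finite.exists_fin' R (R ⧸ J)
    obtain ⟨m', q', hq'⟩ := exists_exact_of_finitePresentation p' hp'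
    obtain ⟨T, τ, h, -⟩ := exists_isTensorObj_of_presentation q' p' hq' hp' A
    exact ⟨T, τ, h⟩
  let τ₂ : R →ₗ[R] (A ⟶ A) := LinearMap.toSpanSingleton R _ (𝟙 A)
  have h₂ : IsTensorObj τ₂ := fun B φ => by
    refine ⟨φ 1, fun x => ?_, fun g hg => by simpa [τ₂] using hg 1⟩
    simp [τ₂, ← map_smul]
  obtain ⟨f, hf, -⟩ := h₁ (τ₂ ∘ₗ J.subtype)
  obtain ⟨g, hg, -⟩ := h₂ (τ₃ ∘ₗ J.mkQ)
  have hfg : f ≫ g = 0 := by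
    refine (h₁ 0).unique (fun x => ?_) fun x => by simp
    rw [← Category.assoc, hf]
    refine (hg _).trans ?_
    have : J.mkQ (J.subtype x) = 0 := (Submodule.Quotient.mk_eq_zero J).2 x.2
    simp only [LinearMap.comp_apply, this, map_zero, LinearMap.zero_apply]
  have hE := hA J R (R ⧸ J) J.subtype J.mkQ J.injective_subtype (LinearMap.exact_subtype_mkQ J)
    J.mkQ_surjective (ShortComplex.mk f g hfg) τ₁ τ₂ τ₃ h₁ h₂ h₃ hf hg
  have : Mono f := hE.mono_f
  obtain ⟨W', e, he, b, hb⟩ := hex W a (by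
    rw [← cancel_mono f]
    have hp1 (i : Fin n) : J.subtype (p (Pi.single i 1)) = c i := by simp [p]
    simp only [Preadditive.sum_comp, Category.assoc, hf, LinearMap.comp_apply, hp1, zero_comp, ← h]
    simp [τ₂])
  refine ⟨W', e, he, m, fun k => q (Pi.single k 1), b, hb, fun k => ?_⟩
  have := congr_arg J.subtype (hq.apply_apply_eq_zero (Pi.single k 1))
  simpa [p, Fintype.linearCombination_apply, mul_comm] using this

end Flat

/-! ### Lifting conditions (G) and (FF) -/

section Effaceable

variable {R : Type r} [CommRing R] {C D : Type*}
  [Category C] [Abelian C] [Linear R C] [Category D]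
  {I : Ideal R} {j : D ⥤ C} {L : C ⥤ D}

omit [Linear R C] in
/-- Finitely many generalized elements lift along an epimorphism on a common refinement. -/
lemma exists_lift_fin {P A : C} (π : P ⟶ A) [Epi π] {m : ℕ} {W : C} (b : Fin m → (W ⟶ A)) :
    ∃ (W' : C) (e : W' ⟶ W) (_ : Epi e) (b' : Fin m → (W' ⟶ P)), ∀ k, e ≫ b k = b' k ≫ π := by
  induction m with
  | zero => exact ⟨W, 𝟙 W, inferInstance, fun k => k.elim0, fun k => k.elim0⟩
  | succ m ih =>
    obtain ⟨W₁, e₁, _, b', hb'⟩ := ih fun k => b k.succ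
    obtain ⟨W₂, e₂, _, x, hx⟩ := surjective_up_to_refinements_of_epi π (e₁ ≫ b 0)
    refine ⟨W₂, e₂ ≫ e₁, inferInstance, Fin.cons x fun k => e₂ ≫ b' k, fun k => ?_⟩
    cases k using Fin.cases with
    | zero => simpa using hx
    | succ k => simp [hb']

/-- The kernel of `π` is annihilated by the ideal `𝔞`. -/
def KerAnnihilated (𝔞 : Ideal R) {P A : C} (π : P ⟶ A) : Prop :=
  ∀ ⦃W : C⦄ (d : W ⟶ P), d ≫ π = 0 → ∀ r ∈ 𝔞, r • d = 0

/-- If `A` is flat and the kernel `K` of the epimorphism `π : P ⟶ A` is annihilated by `I`, then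
`K ∩ I P = 0`, so `K` embeds into the reflection of `P`. -/
lemma KerAnnihilated.eq_zero [IsGrothendieckAbelian.{w} C] (hR : IsCoherentRing R)
    (hj : IsAnnihilatedSubcategory I j) (adj : L ⊣ j) {P A : C} (hA : IsFlatObj R A)
    {π : P ⟶ A} [Epi π] (hπ : KerAnnihilated I π) {W : C} (d : W ⟶ P) (h₁ : d ≫ π = 0)
    (h₂ : d ≫ reflection adj P = 0) : d = 0 := by
  have hd : LandsIn I d := fun Q q hq => by
    obtain ⟨h, rfl⟩ := hj.exists_reflection_comp_eq adj q hq
    rw [reassoc_of% h₂, zero_comp]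
  refine hd.eq_zero_of_sums _ fun n c W' t y hc ht => ?_
  obtain ⟨W₁, e₁, _, m, s, b, hb, hs⟩ := hA.exists_of_sum_smul_eq_zero hR c (fun i => y i ≫ π) (by
    simp only [← Linear.smul_comp, ← Preadditive.sum_comp, ← ht, Category.assoc, h₁, comp_zero])
  obtain ⟨W₂, e₂, _, b', hb'⟩ := exists_lift_fin π b
  have hy (i : Fin n) : c i • (e₂ ≫ e₁ ≫ y i) = ∑ k, (c i * s k i) • b' k := by
    have := hπ (e₂ ≫ e₁ ≫ y i - ∑ k, s k i • b' k)
      (by simp [Preadditive.sum_comp, hb, Preadditive.comp_sum, hb']) _ (hc i)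
    rw [smul_sub, sub_eq_zero] at this
    simp only [this, Finset.smul_sum, smul_smul]
  rw [← cancel_epi e₁, ← cancel_epi e₂, ht, comp_zero, comp_zero]
  simp only [Preadditive.comp_sum, Linear.comp_smul, hy]
  rw [Finset.sum_comm]
  simp only [← Finset.sum_smul, hs, zero_smul, Finset.sum_const_zero]

variable [Preadditive D] [j.Additive]

/-- If `A` is flat and the kernel of the epimorphism `π : P ⟶ A` is annihilated by `I`, then `P` is
the pullback of its reflection along the reflection of `A`. -/
lemma KerAnnihilated.exists_lift [IsGrothendieckAbelian.{w} C] (hR : IsCoherentRing R)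
    (hj : IsAnnihilatedSubcategory I j) (adj : L ⊣ j) {P A : C} (hA : IsFlatObj R A)
    {π : P ⟶ A} [Epi π] (hπ : KerAnnihilated I π) {W : C} (α : W ⟶ j.obj (L.obj P)) (β : W ⟶ A)
    (h : α ≫ j.map (L.map π) = β ≫ reflection adj A) : ∃ l : W ⟶ P, l ≫ π = β := by
  have := hj.epi_reflection adj
  let f : P ⟶ pullback (j.map (L.map π)) (reflection adj A) :=
    pullback.lift (reflection adj P) π (reflection_naturality adj π).symm
  have hfst : f ≫ pullback.fst _ _ = reflection adj P := pullback.lift_fst _ _ _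
  have hsnd : f ≫ pullback.snd _ _ = π := pullback.lift_snd _ _ _
  have : Mono f := Preadditive.mono_of_cancel_zero _ fun {W} d hd =>
    hπ.eq_zero hR hj adj hA d
      (by simpa [hsnd] using hd =≫ pullback.snd _ _) (by simpa [hfst] using hd =≫ pullback.fst _ _)
  have : Epi f := by
    rw [epi_iff_surjective_up_to_refinements]
    intro W y
    obtain ⟨W₁, e₁, _, l', hl'⟩ := surjective_up_to_refinements_of_epi π (y ≫ pullback.snd _ _)
    -- The sequence `K ⟶ reflection of P ⟶ reflection of A` is exact, `K` being the kernel of `π`.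
    let c := cokernel.π (kernel.ι π ≫ reflection adj P)
    have hc : kernel.ι π ≫ reflection adj P ≫ c = 0 := by
      rw [← Category.assoc]; exact cokernel.condition _
    have hc' : π ≫ Abelian.epiDesc π _ hc = reflection adj P ≫ c := Abelian.comp_epiDesc π _ hc
    obtain ⟨ρ, hρ⟩ := hj.exists_reflection_comp_eq adj (Abelian.epiDesc π _ hc) fun r hr => by
      rw [← cancel_epi π, Linear.comp_smul, hc', ← Linear.comp_smul, hj.smul_eq_zero_left c hr,
        comp_zero, comp_zero]
    have hcρ : c = j.map (L.map π) ≫ ρ := by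
      rw [← cancel_epi (reflection adj P), ← hc', ← hρ, reflection_naturality_assoc]
    have hδ : (e₁ ≫ y ≫ pullback.fst _ _ - l' ≫ reflection adj P) ≫ c = 0 := by
      rw [hcρ, ← Category.assoc, Preadditive.sub_comp, Category.assoc l',
        ← reflection_naturality adj π, ← reassoc_of% hl']
      simp [pullback.condition]
    obtain ⟨W₂, e₂, _, x, hx⟩ :=
      (ShortComplex.exact_cokernel (kernel.ι π ≫ reflection adj P)).exact_up_to_refinements _ hδ
    dsimp at x hx
    refine ⟨W₂, e₂ ≫ e₁, inferInstance, e₂ ≫ l' + x ≫ kernel.ι π, ?_⟩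
    ext
    · rw [Preadditive.comp_sub, sub_eq_iff_eq_add] at hx
      simp [hfst, hx, add_comm]
    · simp [hsnd, hl']
  have : IsIso f := isIso_of_mono_of_epi f
  refine ⟨pullback.lift α β h ≫ inv f, ?_⟩
  rw [Category.assoc, (IsIso.inv_comp_eq f).2 hsnd.symm]
  exact pullback.lift_snd _ _ _

variable [L.Additive] {U : Type*} [Category U] {u : U ⥤ C}

/-- The case of a kernel annihilated by `I`: lifts of `u p` along `π` correspond to lifts along the
reflection of `π`, which exist locally because the images under `u ⋙ L` generate. -/
lemma KerAnnihilated.covers [IsGrothendieckAbelian.{w} C] (hR : IsCoherentRing R)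
    (hj : IsAnnihilatedSubcategory I j) (adj : L ⊣ j) (hI : IsNilpotent I)
    (hG : Generates (u ⋙ L)) (hF : LocallyFull (u ⋙ L)) {A : U} (hA : IsFlatObj R (u.obj A))
    {P : C} {π : P ⟶ u.obj A} [Epi π] (hπ : KerAnnihilated I π) :
    Covers u fun Y (p : Y ⟶ A) => ∃ l : u.obj Y ⟶ P, l ≫ π = u.map p := by
  refine Covers.of_comp hj adj hI fun T g hg => ?_
  have := adj.isLeftAdjoint
  rw [← cancel_epi (L.map π), comp_zero]
  refine hG _ fun Y a => ?_
  refine hF (a ≫ L.map π) _ fun Z q ⟨x, hx⟩ => ?_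
  rw [← Category.assoc a, ← Category.assoc, ← hx]
  refine hg x (hπ.exists_lift hR hj adj hA
    (reflection adj _ ≫ j.map ((u ⋙ L).map q ≫ a)) (u.map x) ?_)
  rw [reflection_naturality, Category.assoc, ← j.map_comp]
  congr 2
  simpa using hx.symm

/-- Over a flat `u.obj A`, every epimorphism onto `u.obj A` has lifts of `u p` for the morphisms `p`
of a covering of `A`, if its kernel is annihilated by a power of `I`. The kernel `K` is filtered by
the kernel of `K ⟶ K / I K`. -/
lemma KerAnnihilated.covers_of_pow [IsGrothendieckAbelian.{w} C] (hR : IsCoherentRing R)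
    (hj : IsAnnihilatedSubcategory I j) (adj : L ⊣ j) (hI : IsNilpotent I)
    (hG : Generates (u ⋙ L)) (hF : LocallyFull (u ⋙ L)) (hu : ∀ A, IsFlatObj R (u.obj A))
    (n : ℕ) {A : U} {P : C} (π : P ⟶ u.obj A) [Epi π] (hπ : KerAnnihilated (I ^ n) π) :
    Covers u fun Y (p : Y ⟶ A) => ∃ l : u.obj Y ⟶ P, l ≫ π = u.map p := by
  induction n generalizing A P with
  | zero =>
    have : Mono π := Preadditive.mono_of_cancel_zero _ fun d hd => by
      simpa using hπ d hd 1 (by simp)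
    have := isIso_of_mono_of_epi π
    exact .of_id ⟨inv π, by simp⟩
  | succ n ih =>
    have := hj.epi_reflection adj
    let κ := kernel.ι (reflection adj (kernel π)) ≫ kernel.ι π
    let ρ := cokernel.π κ
    have hκ : κ ≫ π = 0 := by simp [κ]
    let π' := cokernel.desc κ π hκ
    have hρπ : ρ ≫ π' = π := cokernel.π_desc _ _ _
    have : Epi π' := epi_of_epi_fac hρπ
    have hπ' : KerAnnihilated I π' := by
      intro W d hd r hr
      obtain ⟨W', e, _, d', hd'⟩ := surjective_up_to_refinements_of_epi ρ d
      have hd'π : d' ≫ π = 0 := by rw [← hρπ, ← reassoc_of% hd', hd, comp_zero]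
      have h0 : kernel.ι (reflection adj (kernel π)) ≫ kernel.ι π ≫ ρ = 0 := by
        rw [← Category.assoc]; exact cokernel.condition κ
      have h1 : kernel.ι π ≫ ρ = reflection adj (kernel π) ≫ Abelian.epiDesc _ _ h0 :=
        (Abelian.comp_epiDesc _ _ h0).symm
      rw [← cancel_epi e, Linear.comp_smul, hd', ← kernel.lift_ι π d' hd'π, Category.assoc, h1,
        ← Linear.comp_smul, ← Linear.comp_smul, hj.smul_eq_zero_left _ hr]
      simp
    refine (hπ'.covers hR hj adj hI hG hF (hu A)).trans fun Y p ⟨l, hl⟩ => ?_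
    refine (ih (pullback.snd ρ l) ?_).mono fun Z q ⟨l', hl'⟩ => ⟨l' ≫ pullback.fst ρ l, ?_⟩
    · intro W d hd r hr
      -- `I ^ n` annihilates `ker ρ = I K`, since the multiples of `K` by `I ^ n` are annihilated
      -- by `I` and so are quotients of `K / I K`.
      have hd₁ : (d ≫ pullback.fst ρ l) ≫ ρ = 0 := by
        rw [Category.assoc, pullback.condition, reassoc_of% hd, zero_comp]
      obtain ⟨W', e, _, x, hx⟩ := (ShortComplex.exact_cokernel κ).exact_up_to_refinements _ hd₁
      dsimp at x hx
      have hrκ : r • κ = 0 := by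
        obtain ⟨h, hh⟩ := hj.exists_reflection_comp_eq adj (r • kernel.ι π) fun s hs => by
          rw [smul_smul]
          exact hπ _ (kernel.condition π) _ (by rw [pow_succ']; exact Ideal.mul_mem_mul hs hr)
        rw [← Linear.comp_smul, ← hh, kernel.condition_assoc, zero_comp]
      ext
      · rw [← cancel_epi e, Linear.smul_comp, Linear.comp_smul, hx, ← Linear.comp_smul, hrκ]
        simp
      · rw [Linear.smul_comp, hd, smul_zero, zero_comp]
    · rw [u.map_comp, ← hl, ← reassoc_of% hl', ← pullback.condition_assoc, hρπ, Category.assoc]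

/-- Every epimorphism onto `u.obj A` has lifts of `u p` for the morphisms `p` of a covering of
`A`. -/
lemma covers_of_epi [IsGrothendieckAbelian.{w} C] (hR : IsCoherentRing R)
    (hj : IsAnnihilatedSubcategory I j) (adj : L ⊣ j) (hI : IsNilpotent I)
    (hG : Generates (u ⋙ L)) (hF : LocallyFull (u ⋙ L)) (hu : ∀ A, IsFlatObj R (u.obj A))
    {A : U} {P : C} (π : P ⟶ u.obj A) [Epi π] :
    Covers u fun Y (p : Y ⟶ A) => ∃ l : u.obj Y ⟶ P, l ≫ π = u.map p := by
  obtain ⟨n, hn⟩ := id hI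
  refine KerAnnihilated.covers_of_pow hR hj adj hI hG hF hu n π fun W d _ r hr => ?_
  rw [hn] at hr
  rw [(Submodule.mem_bot R).1 hr, zero_smul]

/-- Condition (G) lifts along a reflection modulo a nilpotent ideal. -/
lemma Generates.of_comp [IsGrothendieckAbelian.{w} C] (hR : IsCoherentRing R)
    (hj : IsAnnihilatedSubcategory I j) (adj : L ⊣ j) (hI : IsNilpotent I)
    (hG : Generates (u ⋙ L)) (hF : LocallyFull (u ⋙ L)) (hu : ∀ A, IsFlatObj R (u.obj A)) :
    Generates u := by
  intro X T g hg
  have := hj.epi_reflection adj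
  -- By Nakayama, it is enough to see that the reflection of the epimorphic part of `g` vanishes,
  -- and `u p ≫ b` lifts along the reflection of `X` for the morphisms `p` of a covering.
  rw [← image.fac g, hj.eq_zero_of_map_eq_zero adj hI (factorThruImage g), zero_comp]
  refine hG _ fun A b => ?_
  have hcov := covers_of_epi hR hj adj hI hG hF hu
    (pullback.snd (reflection adj X) (reflection adj (u.obj A) ≫ j.map b))
  refine hcov.comp adj _ fun Y p ⟨l, hl⟩ => ?_
  have hb : (u ⋙ L).map p ≫ b = L.map (l ≫ pullback.fst _ _) := by
    refine reflection_map_injective adj ?_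
    rw [← reflection_naturality, Category.assoc, pullback.condition, reassoc_of% hl,
      reflection_naturality_assoc, j.map_comp]
    rfl
  have hl0 : (l ≫ pullback.fst _ _) ≫ factorThruImage g = 0 := by
    rw [← cancel_mono (image.ι g), Category.assoc, image.fac, hg, zero_comp]
  rw [← Category.assoc, hb, ← L.map_comp, hl0, L.map_zero]

variable [Preadditive U] [Linear R U] [u.Additive] [u.Linear R]

omit [Preadditive D] [Category D] [Category C] [Abelian C] [Linear R C] [Category U]
    [Preadditive U] [Linear R U] in
lemma exists_eq_sum_of_mem_smul_top {M : Type*} [AddCommGroup M] [Module R M] {x : M}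
    (hx : x ∈ I • (⊤ : Submodule R M)) :
    ∃ (n : ℕ) (c : Fin n → R) (y : Fin n → M), (∀ i, c i ∈ I) ∧ x = ∑ i, c i • y i := by
  refine Submodule.smul_induction_on hx (fun r hr y _ => ⟨1, fun _ => r, fun _ => y, ?_⟩) ?_
  · simpa using hr
  · rintro _ _ ⟨n, c, y, hc, rfl⟩ ⟨n', c', y', hc', rfl⟩
    refine ⟨n + n', Fin.append c c', Fin.append y y', fun i => ?_, ?_⟩
    · cases i using Fin.addCases <;> simp [hc, hc']
    · simp [Fin.sum_univ_add]

lemma comp_mem_smul {A B Y : U} (p : Y ⟶ A) {J : Ideal R} {N : Submodule R (A ⟶ B)}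
    {N' : Submodule R (Y ⟶ B)} (hN : ∀ x ∈ N, p ≫ x ∈ N') {x : A ⟶ B} (hx : x ∈ J • N) :
    p ≫ x ∈ J • N' := by
  have h : J • N ≤ (J • N').comap (Linear.leftComp R B p) := by
    refine Submodule.smul_le.2 fun r hr y hy => ?_
    simpa using Submodule.smul_mem_smul hr (hN y hy)
  exact h hx

/-- If `u` annihilates `x`, then `x` belongs locally to `I • ker u`. Indeed `x` is locally a sum of
multiples `c i • x i` with `c i ∈ I`; by flatness the relation `∑ c i • u (x i) = 0` is a
consequence of relations between the `c i`, and these can be realized in `U`. -/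
lemma covers_mem_smul_ker (hR : IsCoherentRing R)
    (hj : IsAnnihilatedSubcategory I j) (adj : L ⊣ j) (hI : IsNilpotent I)
    (hG : Generates u) (hF : LocallyFull u) (hu : ∀ A, IsFlatObj R (u.obj A))
    (hFF : ∀ ⦃A B : U⦄ (x : A ⟶ B), (u ⋙ L).map x = 0 →
      Covers (u ⋙ L) fun Y (p : Y ⟶ A) => p ≫ x ∈ I • (⊤ : Submodule R (Y ⟶ B)))
    {A B : U} (x : A ⟶ B) (hx : u.map x = 0) :
    Covers u fun Y (p : Y ⟶ A) =>
      p ≫ x ∈ I • LinearMap.ker (u.mapLinearMap R : (Y ⟶ B) →ₗ[R] _) := by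
  refine ((hFF x (by simp [hx])).of_comp hj adj hI).trans fun Y p hp => ?_
  have hx' : u.map (p ≫ x) = 0 := by simp [hx]
  simp only [Category.assoc]
  generalize p ≫ x = z at hp hx' ⊢
  intro T g hg
  obtain ⟨n, c, y, hc, rfl⟩ := exists_eq_sum_of_mem_smul_top hp
  obtain ⟨W, e, _, m, s, b, hb, hs⟩ :=
    (hu B).exists_of_sum_smul_eq_zero hR c (fun i => u.map (y i)) (by simpa using hx')
  rw [← cancel_epi e, comp_zero]
  refine hF.eq_zero_of_lifts hG e b _ fun Z d q x' hq hx' => ?_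
  rw [← Category.assoc, ← hq]
  refine hg q ?_
  have h0 : ∑ i, c i • ∑ k, s k i • x' k = 0 := by
    simp only [Finset.smul_sum, smul_smul]
    rw [Finset.sum_comm]
    simp only [← Finset.sum_smul, hs, zero_smul, Finset.sum_const_zero]
  have hsum : q ≫ ∑ i, c i • y i = ∑ i, c i • (q ≫ y i - ∑ k, s k i • x' k) := by
    simp only [smul_sub, Finset.sum_sub_distrib, h0, sub_zero, Preadditive.comp_sum,
      Linear.comp_smul]
  beta_reduce
  rw [hsum]
  refine sum_mem fun i _ => Submodule.smul_mem_smul (hc i) ?_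
  change u.map _ = 0
  rw [u.map_sub, u.map_comp, hq, Category.assoc, hb,
    u.map_sum, sub_eq_zero, Preadditive.comp_sum]
  simp [hx']

/-- Condition (FF) lifts along a reflection modulo a nilpotent ideal. -/
lemma LocallyFaithful.of_comp (hR : IsCoherentRing R)
    (hj : IsAnnihilatedSubcategory I j) (adj : L ⊣ j) (hI : IsNilpotent I)
    (hG : Generates u) (hF : LocallyFull u) (hu : ∀ A, IsFlatObj R (u.obj A))
    (hFF : ∀ ⦃A B : U⦄ (x : A ⟶ B), (u ⋙ L).map x = 0 →
      Covers (u ⋙ L) fun Y (p : Y ⟶ A) => p ≫ x ∈ I • (⊤ : Submodule R (Y ⟶ B))) :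
    LocallyFaithful u := by
  intro A B x hx
  -- Applied repeatedly, the previous lemma shows that `x` lies locally in `I ^ n • ker u`.
  have step (n : ℕ) {Y : U} (z : Y ⟶ B)
      (hz : z ∈ I ^ n • LinearMap.ker (u.mapLinearMap R : (Y ⟶ B) →ₗ[R] _)) :
      ∀ (Z : U) (q : Z ⟶ Y), Covers u fun W (p : W ⟶ Z) =>
        p ≫ q ≫ z ∈ I ^ (n + 1) • LinearMap.ker (u.mapLinearMap R : (W ⟶ B) →ₗ[R] _) := by
    refine Submodule.smul_induction_on hz (fun r hr k hk Z q => ?_) fun a b ha hb Z q => ?_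
    · have hqk : u.map (q ≫ k) = 0 := by
        have : u.map k = 0 := hk
        simp [this]
      refine (covers_mem_smul_ker hR hj adj hI hG hF hu hFF _ hqk).mono fun W p hp => ?_
      rw [Linear.comp_smul, Linear.comp_smul, pow_succ, Submodule.mul_smul]
      exact Submodule.smul_mem_smul hr hp
    · refine (ha Z q).trans fun W p hp => (hb W (p ≫ q)).mono fun W' p' hp' => ?_
      rw [Preadditive.comp_add, Preadditive.comp_add, Category.assoc, Category.assoc]
      refine add_mem (comp_mem_smul p' (fun k hk => ?_) hp) (by simpa using hp')
      have : u.map k = 0 := hk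
      simp [this]
  have key (n : ℕ) : Covers u fun Y (p : Y ⟶ A) =>
      p ≫ x ∈ I ^ n • LinearMap.ker (u.mapLinearMap R : (Y ⟶ B) →ₗ[R] _) := by
    induction n with
    | zero => exact .of_id (by simp [hx])
    | succ n ih =>
      refine ih.trans fun Y p hp => (step n _ hp Y (𝟙 Y)).mono fun Z q hq => ?_
      simpa using hq
  obtain ⟨n, hn⟩ := hI
  refine (key n).mono fun Y p hp => ?_
  rw [hn] at hp
  simpa using hp

end Effaceable

/-! ### Base change along a surjection -/

section BaseChange

open TensorProduct

variable {R S : Type*} [CommRing R] [CommRing S] [Algebra R S] {M N : Type*} [AddCommGroup M]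
  [Module R M] [AddCommGroup N] [Module R N] [Module S N] [IsScalarTower R S N] {g : M →ₗ[R] N}

lemma surjective_of_isBaseChange (hS : Function.Surjective (algebraMap R S))
    (hg : IsBaseChange S g) : Function.Surjective g := by
  intro y
  induction y using hg.inductionOn with
  | zero => exact ⟨0, map_zero g⟩
  | tmul m => exact ⟨m, rfl⟩
  | smul s n h =>
    obtain ⟨m, rfl⟩ := h
    obtain ⟨r, rfl⟩ := hS s
    exact ⟨r • m, by rw [map_smul, algebraMap_smul]⟩
  | add a b ha hb =>
    obtain ⟨a, rfl⟩ := ha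
    obtain ⟨b, rfl⟩ := hb
    exact ⟨a + b, map_add g a b⟩

/-- The kernel of `M ⟶ S ⊗ M` is `I M`, where `I` is the kernel of `R ⟶ S`. -/
lemma mem_ker_smul_top_of_isBaseChange (hS : Function.Surjective (algebraMap R S))
    (hg : IsBaseChange S g) {x : M} (hx : g x = 0) :
    x ∈ RingHom.ker (algebraMap R S) • (⊤ : Submodule R M) := by
  let K := RingHom.ker (algebraMap R S)
  have hex : Function.Exact K.subtype (Algebra.linearMap R S) := by
    intro r
    simp [K, RingHom.mem_ker]
  have h1 : (1 : S) ⊗ₜ[R] x = 0 := hg.equiv.injective (by simp [hg.equiv_tmul, hx])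
  obtain ⟨t, ht⟩ := (rTensor_exact M hex hS (1 ⊗ₜ[R] x)).1 (by simpa using h1)
  have h2 : x = TensorProduct.lid R M (K.subtype.rTensor M t) := by rw [ht]; simp
  rw [h2]
  clear ht h2
  induction t with
  | zero => simp
  | tmul a m =>
    simpa using Submodule.smul_mem_smul a.2 (Submodule.mem_top (R := R) (x := m))
  | add a b ha hb => simpa using add_mem ha hb

end BaseChange

/-! ### Comparison with covering systems -/

section Translation

variable {U C : Type*} [Category U] [Category C] [Preadditive C]

lemma Covers.of_iso {u u' : U ⥤ C} (e : u ≅ u') {A : U} {P : ∀ ⦃Y : U⦄, (Y ⟶ A) → Prop}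
    (hP : Covers u P) : Covers u' P := by
  intro T g hg
  rw [← cancel_epi (e.hom.app A), comp_zero]
  refine hP _ fun Y p hp => ?_
  rw [e.hom.naturality_assoc, hg p hp, comp_zero]

lemma Generates.of_iso {u u' : U ⥤ C} (e : u ≅ u') (h : Generates u) : Generates u' :=
  fun _ _ g hg => h g fun A a => by
    simpa using e.hom.app A ≫= hg A (e.inv.app A ≫ a)

lemma LocallyFull.of_iso {u u' : U ⥤ C} (e : u ≅ u') (h : LocallyFull u) : LocallyFull u' :=
  fun A B y => ((h (e.hom.app A ≫ y ≫ e.inv.app B)).of_iso e).mono fun Y p ⟨x, hx⟩ => ⟨x, by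
    rw [← cancel_epi (e.hom.app Y), ← e.hom.naturality, hx, ← e.hom.naturality_assoc]
    simp⟩

lemma Generates.satisfiesG [LocallySmall.{w} C] {U : Type w} [SmallCategory U] {u : U ⥤ C}
    (h : Generates u) : SatisfiesG (epiCoveringSystem.{w} C) u := by
  intro X
  refine ⟨Σ A : U, Shrink.{w} (u.obj A ⟶ X), fun i => i.1, fun i => (equivShrink _).symm i.2,
    fun T a b hab => ?_⟩
  rw [← sub_eq_zero]
  refine h _ fun A y => ?_
  have := hab ⟨A, equivShrink _ y⟩
  simpa [sub_eq_zero] using this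

/-- A covering may be indexed by a small set, `U` being small. -/
lemma Covers.exists_covering {U : Type w} [SmallCategory U] {u : U ⥤ C} {A : U}
    {P : ∀ ⦃Y : U⦄, (Y ⟶ A) → Prop} (h : Covers u P) :
    ∃ (ι : Type w) (Y : ι → U) (p : ∀ i, Y i ⟶ A),
      ((epiCoveringSystem.{w} C).induced u).Covers Y p ∧ ∀ i, P (p i) := by
  refine ⟨{q : Σ Y : U, (Y ⟶ A) // P q.2}, fun q => q.1.1, fun q => q.1.2, fun T a b hab => ?_,
    fun q => q.2⟩
  rw [← sub_eq_zero]
  refine h _ fun Y p hp => ?_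
  have : u.map p ≫ a = u.map p ≫ b := hab ⟨⟨Y, p⟩, hp⟩
  simp [this]

lemma satisfiesGFFF_of_locally [LocallySmall.{w} C] {U : Type w} [SmallCategory U] [Preadditive U]
    {u : U ⥤ C} (hG : Generates u) (hF : LocallyFull u) (hFF : LocallyFaithful u) :
    SatisfiesGFFF.{w} u where
  G := hG.satisfiesG
  F _ _ y := (hF y).exists_covering
  FF _ _ x hx := (hFF x hx).exists_covering

variable {V : Type*} [Category V] {v : V ⥤ C} {f : U ⥤ V}

lemma Generates.of_satisfiesG [f.EssSurj] (h : SatisfiesG (epiCoveringSystem.{w} C) v) :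
    Generates (f ⋙ v) := by
  intro X T g hg
  obtain ⟨ι, A, p, hp⟩ := h X
  refine hp g 0 fun i => ?_
  have := hg _ (v.map (f.objObjPreimageIso (A i)).hom ≫ p i)
  rw [← cancel_epi (v.map (f.objObjPreimageIso (A i)).hom)]
  simpa using this

/-- A property of the morphisms to `A` holds on a covering for `f ⋙ v` if the corresponding
property holds on a covering of `f.obj A` for `v`. -/
lemma covers_of_covering [f.EssSurj] [f.Full] {A : U} {ι : Type w} {Y : ι → V}
    {p : ∀ i, Y i ⟶ f.obj A} (hp : ((epiCoveringSystem.{w} C).induced v).Covers Y p)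
    {P : ∀ ⦃Z : U⦄, (Z ⟶ A) → Prop}
    (h : ∀ i (Z : U) (σ : f.obj Z ≅ Y i) (q : Z ⟶ A), f.map q = σ.hom ≫ p i → P q) :
    Covers (f ⋙ v) P := by
  intro T g hg
  refine hp g 0 fun i => ?_
  let σ := f.objObjPreimageIso (Y i)
  obtain ⟨q, hq⟩ := f.map_surjective (σ.hom ≫ p i)
  have := hg q (h i _ σ q hq)
  rw [← cancel_epi (v.map σ.hom)]
  simpa [hq] using this

lemma LocallyFull.of_satisfiesF [f.EssSurj] [f.Full]
    (h : SatisfiesF ((epiCoveringSystem.{w} C).induced v) v) : LocallyFull (f ⋙ v) := by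
  intro A B y
  obtain ⟨ι, Y, p, hp, hx⟩ := h _ _ y
  refine covers_of_covering hp fun i Z σ q hq => ?_
  obtain ⟨x, hx⟩ := hx i
  obtain ⟨x', hx'⟩ := f.map_surjective (σ.hom ≫ x)
  exact ⟨x', by simp [hx', hx, hq]⟩

end Translation

end LinDef

open LinDef
theorem mainTheorem7
    -- the surjective ring map with nilpotent kernel
    (R : Type r) (S : Type s) [CommRing R] [CommRing S] [Algebra R S]
    (hR : IsCoherentRing R) (hS : IsCoherentRing S)
    (hsurj : Function.Surjective (algebraMap R S))
    (hnil : IsNilpotent (RingHom.ker (algebraMap R S)))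
    -- the small linear categories
    (U : Type w) [SmallCategory U] [Preadditive U] [Linear R U]
    (V : Type w) [SmallCategory V] [Preadditive V] [Linear R V] [Linear S V]
    [∀ A B : V, IsScalarTower R S (A ⟶ B)]
    -- the linear Grothendieck categories
    (C : Type u₁) [Category.{v₁} C] [Abelian C] [IsGrothendieckAbelian.{w} C] [Linear R C]
    (D : Type u₂) [Category.{v₂} D] [Abelian D] [IsGrothendieckAbelian.{w} D]
    [Linear R D] [Linear S D] [∀ A B : D, IsScalarTower R S (A ⟶ B)]
    -- the square
    (u : U ⥤ C) [u.Additive] [u.Linear R]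
    (v : V ⥤ D) [v.Additive] [v.Linear S]
    (f : U ⥤ V) [f.Additive] [f.Linear R] (hf : IsLinearDeformation R S f)
    (j : D ⥤ C) [j.Additive] [j.Linear R] (hj : IsAbelianDeformation R S j)
    (L : C ⥤ D) (adj : L ⊣ j)
    (comm : Nonempty (u ⋙ L ≅ f ⋙ v))
    (hflat : ∀ A : U, IsFlatObj R (u.obj A))
    (hv : SatisfiesGFFF.{w} v) :
    SatisfiesGFFF.{w} u := by
  obtain ⟨φ⟩ := comm
  have hj' := hj.isAnnihilatedSubcategory
  have : L.Additive := adj.left_adjoint_additive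
  have := hf.essSurj
  have : f.Full := ⟨fun y => surjective_of_isBaseChange hsurj (hf.isBaseChange _ _) y⟩
  have hG : Generates (u ⋙ L) := (Generates.of_satisfiesG hv.G).of_iso φ.symm
  have hF : LocallyFull (u ⋙ L) := (LocallyFull.of_satisfiesF hv.F).of_iso φ.symm
  have hFF ⦃A B : U⦄ (x : A ⟶ B) (hx : (u ⋙ L).map x = 0) : Covers (u ⋙ L) fun Y (p : Y ⟶ A) =>
      p ≫ x ∈ RingHom.ker (algebraMap R S) • (⊤ : Submodule R (Y ⟶ B)) := by
    have hx' : v.map (f.map x) = 0 := by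
      have h := φ.hom.naturality x
      rw [hx, zero_comp] at h
      exact (cancel_epi (φ.hom.app A)).1 (h.symm.trans comp_zero.symm)
    obtain ⟨ι, Y, p, hp, h0⟩ := hv.FF _ _ _ hx'
    refine (covers_of_covering hp fun i Z σ q hq => ?_).of_iso φ.symm
    refine mem_ker_smul_top_of_isBaseChange hsurj (hf.isBaseChange _ _) ?_
    change f.map _ = 0
    rw [f.map_comp, hq, Category.assoc, h0, comp_zero]
  have hGu : Generates u := hG.of_comp hR hj' adj hnil hF hflat
  have hFu : LocallyFull u := hF.of_comp hj' adj hnil hG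
  exact satisfiesGFFF_of_locally hGu hFu (.of_comp hR hj' adj hnil hGu hFu hflat hFF)
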